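/- Let $K$ be a field of characteristic $0$; all vector spaces and Lie algebras are over $K$, of arbitrary dimension. **Formal series.** For vector spaces $E,F$ and $m\ge 0$ let $F[E]_m$ be the space of maps $f:E\to F$ of the form $f(x)=u(x,\dots,x)$ with $u:E^m\to F$ an $m$-linear map (we say that $u$ determines $f$), and let $F[[E]]=\prod_{m\ge 0}F[E]_m$. For $\xi\in E[E]_r$ and $f\in F[E]_m$ determined by $u$, let $(\xi f)(x)=\sum_{i=1}^m u(x,\dots,\xi(x),\dots,x)$ with $\xi(x)$ in the $i$-th place; this does not depend on the choice of $u$. For series $\xi=(\xi_r)\in E[[E]]$ and $f=(f_m)\in F[[E]]$ the derivative of $f$ along $\xi$ is $\xi f\in F[[E]]$, with $(\xi f)_n=\sum_{r+m=n+1}\xi_r f_m$ for $n\ge 0$. **Wreath product.** Let $A,B$ be Lie algebras. $A[[B]]$ is a Lie algebra with the bracket $[f,g]_n(y)=\sum_{k+r=n}[f_k(y),g_r(y)]$. Define $t_n\in K$ by $$\frac{T e^T}{e^T-1}=\sum_{n\ge 0}t_nT^n ,$$ and, for $b\in B$, the series $d_b\in B[[B]]$ by $d_{b,n}(y)=t_n(\operatorname{ad}y)^n(b)$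 (the fundamental action of $B$ on itself). The wreath product $W(A,B)$ is the vector space $A[[B]]\times B$ with the bracket $$[(a,b),(a',b')]=([a,a']+d_b a'-d_{b'}a,\ [b,b']).$$ **Theorem.** The map $\sigma$ which sends $b\in B$ to $a\mapsto d_b a$ is a Lie algebra homomorphism from $B$ into the derivations of the Lie algebra $A[[B]]$, so that $W(A,B)$ is a Lie algebra, the semidirect product of $A[[B]]$ and $B$ along $\sigma$. Let $A\to C\xrightarrow{\,p\,}B$ be an extension of Lie algebras ($p$ is a surjective homomorphism, and $A$ is identified with its kernel), and let $s:B\to C$ be any linear map with $p\circ s=\mathrm{id}_B$. For $c\in C$, $y\in B$, $m\ge 0$ put $z=s(y)$ and $$h_{c,m}(y)=\frac{1}{m!}(\operatorname{ad}z)^m(c)-\sum_{n+r=m}\frac{t_r}{(n+1)!}(\operatorname{ad}z)^n\,(s\circ p)\,(\operatorname{ad}z)^r(c).$$ Then $h_{c,m}(y)\in A$ for all $y$, the map $h_{c,m}$ belongs to $A[B]_m$, and, with $h_c=(h_{c,m})_{m\ge 0}\in A[[B]]$, the map $$f_s:C\to W(A,B),\qquad f_s(c)=(h_c,p(c))$$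 is an injective homomorphism of Lie algebras. -/

import Mathlib

open Finset.HasAntidiagonal (antidiagonal mem_antidiagonal)
open scoped Nat

noncomputable section

namespace LieWreath

/-! ### Homogeneous polynomials and formal series between vector spaces -/

section Series

variable (K : Type*) [Field K]
variable (E : Type*) [AddCommGroup E] [Module K E]
variable (F : Type*) [AddCommGroup F] [Module K F]

/-- `F[E]_m`: the space of maps `f : E → F` which are homogeneous polynomials of degree `m`, i.e. for
which there is an `m`-linear map `u` on `E` with values in `F` such that `f x = u (x, …, x)`. -/
def homPoly (m : ℕ) : Submodule K (E → F) where
  carrier := {f | ∃ u : MultilinearMap K (fun _ : Fin m => E) F, ∀ x, f x = u (fun _ => x)}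
  add_mem' := by
    rintro f g ⟨u, hu⟩ ⟨v, hv⟩
    exact ⟨u + v, fun x => by simp [hu, hv]⟩
  zero_mem' := ⟨0, fun x => by simp⟩
  smul_mem' := by
    rintro c f ⟨u, hu⟩
    exact ⟨c • u, fun x => by simp [hu]⟩

/-- `F[[E]] = ∏ₘ F[E]_m` (over all `m ≥ 0`): the formal series with variables in `E` and coefficients
in `F`. The homogeneous component of degree `m` of `f` is `f m`, a function `E → F`. -/
def Series : Type _ := ∀ m : ℕ, homPoly K E F m

instance : AddCommGroup (Series K E F) := inferInstanceAs (AddCommGroup (∀ m : ℕ, homPoly K E F m))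

instance : Module K (Series K E F) := inferInstanceAs (Module K (∀ m : ℕ, homPoly K E F m))

end Series

section SeriesLemmas

variable {K : Type*} [Field K]
variable {E : Type*} [AddCommGroup E] [Module K E]
variable {F : Type*} [AddCommGroup F] [Module K F]

theorem Series.ext {f g : Series K E F} (h : ∀ m x, (f m).1 x = (g m).1 x) : f = g :=
  funext fun m => Subtype.ext (funext fun x => h m x)

@[simp] theorem Series.add_val (f g : Series K E F) (m : ℕ) (x : E) :
    ((f + g) m).1 x = (f m).1 x + (g m).1 x := rfl

@[simp] theorem Series.zero_val (m : ℕ) (x : E) : ((0 : Series K E F) m).1 x = 0 := rfl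

@[simp] theorem Series.smul_val (c : K) (f : Series K E F) (m : ℕ) (x : E) :
    ((c • f) m).1 x = c • (f m).1 x := rfl

/-! ### Derivative of a series along a series -/

/-- For an `m`-linear map `u`, the sum of all the terms `u (x, …, v, …, x)` in which exactly one
argument is equal to `v` and all the others are equal to `x`. -/
def insertSum {m : ℕ} (u : MultilinearMap K (fun _ : Fin m => E) F) (x v : E) : F :=
  ∑ i : Fin m, u (Function.update (fun _ => x) i v)

/-- Over a field of characteristic zero, `insertSum u` depends only on the homogeneous polynomial
determined by `u`. -/
theorem insertSum_congr [CharZero K] {m : ℕ} {u v : MultilinearMap K (fun _ : Fin m => E) F}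
    (h : ∀ x, u (fun _ => x) = v (fun _ => x)) (x w : E) :
    insertSum u x w = insertSum v x w := by
  classical
  suffices H : ∀ ψ : Module.Dual K F, ψ (insertSum u x w) = ψ (insertSum v x w) by
    rw [← sub_eq_zero]
    refine (Module.forall_dual_apply_eq_zero_iff K _).1 fun ψ => ?_
    rw [map_sub, H, sub_self]
  intro ψ
  let P : MultilinearMap K (fun _ : Fin m => E) F → Polynomial K := fun u =>
    ∑ s : Finset (Fin m),
      Polynomial.C (ψ (u (s.piecewise (fun _ => w) (fun _ => x)))) * Polynomial.X ^ s.card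
  have hev : ∀ (u : MultilinearMap K (fun _ : Fin m => E) F) (t : K),
      (P u).eval t = ψ (u (fun _ => t • w + x)) := by
    intro u t
    have h1 := u.map_add_univ (fun _ => t • w) (fun _ => x)
    have h2 : (fun _ : Fin m => t • w + x) = (fun _ => t • w) + (fun _ => x) := rfl
    rw [h2, h1, map_sum, Polynomial.eval_finsetSum]
    refine Finset.sum_congr rfl fun s _ => ?_
    have h3 := u.map_piecewise_smul (fun _ => t) (s.piecewise (fun _ => w) (fun _ => x)) s
    have h4 : s.piecewise (fun i => (fun _ : Fin m => t) i •
        s.piecewise (fun _ => w) (fun _ => x) i) (s.piecewise (fun _ => w) (fun _ => x))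
        = s.piecewise (fun _ => t • w) (fun _ => x) := by
      funext i
      by_cases hi : i ∈ s <;> simp [hi]
    rw [h4] at h3
    rw [h3]
    simp only [Finset.prod_const, map_smul, smul_eq_mul, Polynomial.eval_mul, Polynomial.eval_C,
      Polynomial.eval_pow, Polynomial.eval_X]
    ring
  have hP : P u = P v := Polynomial.funext fun t => by rw [hev, hev, h]
  have hco : ∀ u : MultilinearMap K (fun _ : Fin m => E) F,
      (P u).coeff 1 = ψ (insertSum u x w) := by
    intro u
    have h1 : (P u).coeff 1 = ∑ s ∈ (Finset.univ : Finset (Finset (Fin m))).filter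
        (fun s => s.card = 1), ψ (u (s.piecewise (fun _ => w) (fun _ => x))) := by
      simp only [P, Polynomial.finsetSum_coeff, Polynomial.coeff_C_mul, Polynomial.coeff_X_pow,
        Finset.sum_filter, mul_ite, mul_one, mul_zero, eq_comm]
    rw [h1, insertSum, map_sum]
    symm
    refine Finset.sum_bij (fun i _ => {i}) ?_ ?_ ?_ ?_
    · intro i _; simp
    · intro i _ j _ hij; simpa using hij
    · intro s hs
      obtain ⟨i, rfl⟩ := Finset.card_eq_one.1 (Finset.mem_filter.1 hs).2
      exact ⟨i, Finset.mem_univ _, rfl⟩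
    · intro i _
      congr 2
      funext j
      by_cases hj : j = i <;> simp [hj]
  rw [← hco, ← hco, hP]

/-- The derivative `ξ f` of the homogeneous polynomial `f` along the homogeneous polynomial `ξ`:
if `f` is determined by `u`, then `(ξ f) x` is the sum of the terms `u (x, …, ξ x, …, x)`. -/
def polyDeriv {r m : ℕ} (ξ : homPoly K E E r) (f : homPoly K E F m) (x : E) : F :=
  insertSum f.2.choose x (ξ.1 x)

/-- The value of `ξ f` may be computed from any multilinear map determining `f`. -/
theorem polyDeriv_eq [CharZero K] {r m : ℕ} (ξ : homPoly K E E r) (f : homPoly K E F m)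
    (u : MultilinearMap K (fun _ : Fin m => E) F) (hu : ∀ x, f.1 x = u (fun _ => x)) (x : E) :
    polyDeriv ξ f x = insertSum u x (ξ.1 x) :=
  insertSum_congr (fun y => by rw [← hu y, ← f.2.choose_spec y]) x _

/-- `ξ f` is a homogeneous polynomial of degree `r + m - 1` (and is zero if `m = 0`). -/
theorem polyDeriv_mem {r m s : ℕ} (h : r + m = s + 1) (ξ : homPoly K E E r)
    (f : homPoly K E F m) : polyDeriv ξ f ∈ homPoly K E F s := by
  classical
  obtain ⟨v, hv⟩ := ξ.2
  set u := f.2.choose with hu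
  have key : polyDeriv ξ f = ∑ i : Fin m, fun x => u (Function.update (fun _ => x) i (v fun _ => x)) := by
    funext x
    simp [polyDeriv, insertSum, hv, hu]
  rw [key]
  refine Submodule.sum_mem _ fun i _ => ?_
  obtain _ | k := m
  · exact i.elim0
  obtain rfl : r + k = s := by omega
  let u' := u.domDomCongr (Equiv.swap i 0)
  let g : MultilinearMap K (fun _ : Fin r => E) (MultilinearMap K (fun _ : Fin k => E) F) :=
    u'.curryLeft.compMultilinearMap v
  let G : MultilinearMap K (fun _ : Fin r ⊕ Fin k => E) F :=
    MultilinearMap.uncurrySum (N := fun _ => E) g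
  refine ⟨G.domDomCongr finSumFinEquiv, fun x => ?_⟩
  change u _ = u (fun j => (Fin.cons (v fun _ => x) (fun _ => x) : Fin (k + 1) → E) (Equiv.swap i 0 j))
  congr 1
  funext j
  by_cases hj : j = i
  · subst hj; simp
  · have : Equiv.swap i 0 j ≠ 0 := by
      intro h0
      apply hj
      have := congrArg (Equiv.swap i 0) h0
      simpa using this
    obtain ⟨l, hl⟩ := Fin.exists_succ_eq.2 this
    rw [← hl]
    simp [hj]

/-- The derivative `ξ f` of the series `f` along the series `ξ`: its component of degree `s` is
`∑_{r + m - 1 = s} ξ_r f_m`. -/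
def Series.along (ξ : Series K E E) (f : Series K E F) : Series K E F := fun s =>
  ⟨∑ p ∈ (antidiagonal (s + 1)).attach, polyDeriv (ξ p.1.1) (f p.1.2),
    Submodule.sum_mem _ fun p _ => polyDeriv_mem (mem_antidiagonal.1 p.2) _ _⟩

theorem Series.along_val (ξ : Series K E E) (f : Series K E F) (s : ℕ) (x : E) :
    ((ξ.along f) s).1 x = ∑ p ∈ antidiagonal (s + 1), polyDeriv (ξ p.1) (f p.2) x := by
  have h := Finset.sum_attach (antidiagonal (s + 1)) fun p => polyDeriv (ξ p.1) (f p.2) x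
  rw [← h]
  simp [Series.along]

end SeriesLemmas

/-! ### The Lie algebra `A[[Y]]` -/

section SeriesLie

variable {K : Type*} [Field K]
variable {Y : Type*} [AddCommGroup Y] [Module K Y]
variable {A : Type*} [LieRing A] [LieAlgebra K A]

theorem lie_mem_homPoly {n r s : ℕ} (h : n + r = s) (f : homPoly K Y A n) (g : homPoly K Y A r) :
    (fun y => ⁅f.1 y, g.1 y⁆) ∈ homPoly K Y A s := by
  subst h
  obtain ⟨u, hu⟩ := f.2
  obtain ⟨v, hv⟩ := g.2
  let L : A →ₗ[K] (MultilinearMap K (fun _ : Fin r => Y) A) :=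
    { toFun := fun a => ((LieAlgebra.ad K A a : Module.End K A)).compMultilinearMap v
      map_add' := fun a b => by ext; simp
      map_smul' := fun c a => by ext; simp }
  let G : MultilinearMap K (fun _ : Fin n ⊕ Fin r => Y) A :=
    MultilinearMap.uncurrySum (N := fun _ => Y) (L.compMultilinearMap u)
  refine ⟨G.domDomCongr finSumFinEquiv, fun y => ?_⟩
  change ⁅f.1 y, g.1 y⁆ = _
  rw [hu, hv]
  rfl

/-- The bracket of `A[[Y]]`: `[f, g]_s (y) = ∑_{n + r = s} [f_n (y), g_r (y)]`. -/
instance : Bracket (Series K Y A) (Series K Y A) where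
  bracket f g := fun s =>
    ⟨∑ p ∈ (antidiagonal s).attach, fun y => ⁅(f p.1.1).1 y, (g p.1.2).1 y⁆,
      Submodule.sum_mem _ fun p _ => lie_mem_homPoly (mem_antidiagonal.1 p.2) _ _⟩

theorem Series.lie_val (f g : Series K Y A) (s : ℕ) (y : Y) :
    (⁅f, g⁆ s).1 y = ∑ p ∈ antidiagonal s, ⁅(f p.1).1 y, (g p.2).1 y⁆ := by
  have h := Finset.sum_attach (antidiagonal s) fun p => ⁅(f p.1).1 y, (g p.2).1 y⁆
  rw [← h]
  simp [Bracket.bracket]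

instance : LieRing (Series K Y A) where
  add_lie f g h := Series.ext fun s y => by
    simp [Series.lie_val, Finset.sum_add_distrib]
  lie_add f g h := Series.ext fun s y => by
    simp [Series.lie_val, Finset.sum_add_distrib]
  lie_self f := Series.ext fun s y => by
    rw [Series.lie_val, Series.zero_val]
    refine Finset.sum_involution (fun p _ => p.swap) ?_ ?_ ?_ ?_
    · intro p _
      simp only [Prod.fst_swap, Prod.snd_swap]
      rw [← lie_skew, neg_add_cancel]
    · intro p _ hp h
      apply hp
      have : p.2 = p.1 := congrArg Prod.fst h
      rw [this, lie_self]
    · intro p hp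
      rw [mem_antidiagonal] at hp ⊢
      simpa [add_comm] using hp
    · intro p _
      simp
  leibniz_lie f g h := Series.ext fun s y => by
    have e1 : (⁅f, ⁅g, h⁆⁆ s).1 y = ∑ p ∈ antidiagonal s, ∑ q ∈ antidiagonal p.2,
        ⁅(f p.1).1 y, ⁅(g q.1).1 y, (h q.2).1 y⁆⁆ := by
      simp only [Series.lie_val, lie_sum]
    have e2 : (⁅⁅f, g⁆, h⁆ s).1 y = ∑ p ∈ antidiagonal s, ∑ q ∈ antidiagonal p.2,
        ⁅⁅(f p.1).1 y, (g q.1).1 y⁆, (h q.2).1 y⁆ := by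
      simp only [Series.lie_val, sum_lie]
      rw [Finset.sum_sigma', Finset.sum_sigma']
      refine Finset.sum_nbij' (fun a => ⟨(a.2.1, a.2.2 + a.1.2), (a.2.2, a.1.2)⟩)
        (fun a => ⟨(a.1.1 + a.2.1, a.2.2), (a.1.1, a.2.1)⟩) ?_ ?_ ?_ ?_ ?_
      all_goals
        rintro ⟨⟨a, b⟩, ⟨c, d⟩⟩ h0
        simp only [Finset.mem_sigma, mem_antidiagonal] at h0
        obtain ⟨h1, h2⟩ := h0
        subst h2
        subst h1
        simp [add_assoc]
    have e3 : (⁅g, ⁅f, h⁆⁆ s).1 y = ∑ p ∈ antidiagonal s, ∑ q ∈ antidiagonal p.2,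
        ⁅(g q.1).1 y, ⁅(f p.1).1 y, (h q.2).1 y⁆⁆ := by
      simp only [Series.lie_val, lie_sum]
      rw [Finset.sum_sigma', Finset.sum_sigma']
      refine Finset.sum_nbij' (fun a => ⟨(a.2.1, a.1.1 + a.2.2), (a.1.1, a.2.2)⟩)
        (fun a => ⟨(a.2.1, a.1.1 + a.2.2), (a.1.1, a.2.2)⟩) ?_ ?_ ?_ ?_ ?_
      all_goals
        rintro ⟨⟨a, b⟩, ⟨c, d⟩⟩ h0
        simp only [Finset.mem_sigma, mem_antidiagonal] at h0
        obtain ⟨h1, h2⟩ := h0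
        subst h2
        subst h1
        simp [add_left_comm]
    rw [Series.add_val, e1, e2, e3, ← Finset.sum_add_distrib]
    refine Finset.sum_congr rfl fun p _ => ?_
    rw [← Finset.sum_add_distrib]
    refine Finset.sum_congr rfl fun q _ => ?_
    exact leibniz_lie _ _ _

instance : LieAlgebra K (Series K Y A) where
  lie_smul c f g := Series.ext fun s y => by
    simp [Series.lie_val, Finset.smul_sum]

end SeriesLie

/-! ### The coefficients `tₙ` and the fundamental action -/

section Fundamental

variable (K : Type*) [Field K]

/-- The generating series `G(T) = T e^T / (e^T - 1)`, written as `e^T` divided by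
`(e^T - 1) / T = ∑ T ^ n / (n + 1)!`. -/
def genSeries [CharZero K] : PowerSeries K :=
  PowerSeries.exp K * (PowerSeries.mk fun n => (((n + 1)! : ℕ) : K)⁻¹)⁻¹

theorem genSeries_mul [CharZero K] :
    genSeries K * (PowerSeries.exp K - 1) = PowerSeries.X * PowerSeries.exp K := by
  have h1 : PowerSeries.exp K - 1 =
      PowerSeries.X * (PowerSeries.mk fun n => (((n + 1)! : ℕ) : K)⁻¹) := by
    ext n
    obtain _ | n := n
    · simp
    · simp [PowerSeries.coeff_succ_X_mul, PowerSeries.coeff_exp, PowerSeries.coeff_one]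
  have h2 : PowerSeries.constantCoeff (PowerSeries.mk fun n => (((n + 1)! : ℕ) : K)⁻¹) ≠ 0 := by
    simp [← PowerSeries.coeff_zero_eq_constantCoeff_apply]
  rw [h1, genSeries]
  have h3 := PowerSeries.inv_mul_cancel _ h2
  linear_combination (PowerSeries.X * PowerSeries.exp K) * h3

/-- The coefficients `tₙ`, defined by `T e^T / (e^T - 1) = ∑ tₙ T ^ n`. -/
def tCoeff (n : ℕ) [CharZero K] : K := PowerSeries.coeff n (genSeries K)

variable {B : Type*} [LieRing B] [LieAlgebra K B]

variable {K} in
theorem ad_pow_mem_homPoly {E : Type*} [AddCommGroup E] [Module K E] (s : E →ₗ[K] B) (b : B)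
    (n : ℕ) : (fun y => ((LieAlgebra.ad K B (s y)) ^ n) b) ∈ homPoly K E B n := by
  induction n with
  | zero => exact ⟨MultilinearMap.constOfIsEmpty K _ b, fun y => by simp⟩
  | succ n ih =>
    have h0 : (fun y => s y) ∈ homPoly K E B 1 :=
      ⟨LinearMap.compMultilinearMap s (MultilinearMap.ofSubsingleton K E E (0 : Fin 1) LinearMap.id),
        fun y => by simp⟩
    have := lie_mem_homPoly (add_comm 1 n) ⟨_, h0⟩ ⟨_, ih⟩
    simpa [pow_succ'] using this

variable {K} in
/-- The fundamental action of `B` on itself: `d_b` is the series whose component of degree `n` is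
`y ↦ tₙ (ad y)ⁿ (b)`. -/
def fundAction [CharZero K] (b : B) : Series K B B := fun n =>
  ⟨fun y => tCoeff K n • ((LieAlgebra.ad K B y) ^ n) b,
    Submodule.smul_mem _ _ (ad_pow_mem_homPoly LinearMap.id b n)⟩

variable {C : Type*} [LieRing C] [LieAlgebra K C]

variable {K} in
/-- With `z = s y`, the element
`(1 / m!) (ad z)^m (c) - ∑_{n + r = m} (t_r / (n + 1)!) (ad z)^n (s ∘ p) (ad z)^r (c)` of `C`. -/
def repFormula [CharZero K] (p : C →ₗ⁅K⁆ B) (s : B →ₗ[K] C) (c : C) (m : ℕ) (y : B) : C :=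
  ((m ! : ℕ) : K)⁻¹ • ((LieAlgebra.ad K C (s y)) ^ m) c -
    ∑ q ∈ antidiagonal m, (tCoeff K q.2 / (((q.1 + 1)! : ℕ) : K)) •
      ((LieAlgebra.ad K C (s y)) ^ q.1) (s (p (((LieAlgebra.ad K C (s y)) ^ q.2) c)))

end Fundamental

end LieWreath

end

/-! Regard `ξ ∈ B[[B]]` as a formal vector field on `B`. Put `φ(T) = (e^T - 1)/T`, `z = s y`, `E_c =
e^{ad z} c` and `Φ(ξ) = φ(ad z)(s ξ)`. Two identities, valid for every linear `s : B → C`, carry the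
proof: `ξ E_c = [Φ(ξ), E_c]` (`along_expSeries`), which differentiates the adjoint action of `e^z`,
and the Maurer-Cartan equation `ξ Φ(η) - η Φ(ξ) = Φ(ξη - ηξ) + [Φ(ξ), Φ(η)]`
(`along_phiSeries_sub`). Moreover `[E_c, E_c'] = E_[c,c']`, since `e^{ad z}` is an automorphism.

The numbers `t_n` are chosen so that, for `s = id`, `Φ(d_b) = E_b`. Maurer-Cartan for `d_b, d_b'`
then reads `Φ(d_b d_b' - d_b' d_b) = E_[b,b']`; as `Φ` is injective, `b ↦ d_b` is a homomorphism to
vector fields. Vector fields act on `A[[B]]` by derivations, and their commutator acts as the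
commutator of the actions because second derivatives are symmetric. This gives `σ`.

For an extension, `h_c = E_c - Φ(d_{p c})`. Applying `p` gives `E_{p c} - E_{p c} = 0`, so `h_c` has
values in `A`. Expanding with the two identities gives the homomorphism law (`repSeries_lie`). If `p
c = 0`, the constant term of `h_c` is `c`, whence injectivity. -/

noncomputable section

namespace LieWreath

/-! ### Derivatives of polynomial maps as first-order terms along lines. -/

section FormalDeriv

variable {K : Type*} [Field K]
variable {E : Type*} [AddCommGroup E] [Module K E]
variable {F : Type*} [AddCommGroup F] [Module K F]
variable {G : Type*} [AddCommGroup G] [Module K G]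

variable (K F) in
/-- The polynomial curves in `F` all of whose monomials have degree at least `d`. -/
def polyCurve (d : ℕ) : Submodule K (K → F) :=
  Submodule.span K {g | ∃ k, d ≤ k ∧ ∃ c : F, g = fun t => t ^ k • c}

theorem monomial_mem_polyCurve {d k : ℕ} (h : d ≤ k) (c : F) :
    (fun t : K => t ^ k • c) ∈ polyCurve K F d :=
  Submodule.subset_span ⟨k, h, c, rfl⟩

theorem const_mem_polyCurve (c : F) : (fun _ : K => c) ∈ polyCurve K F 0 := by
  simpa using monomial_mem_polyCurve (K := K) (le_refl 0) c

theorem linear_mem_polyCurve (c : F) : (fun t : K => t • c) ∈ polyCurve K F 1 := by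
  simpa using monomial_mem_polyCurve (K := K) (le_refl 1) c

theorem polyCurve_antitone {d e : ℕ} (h : d ≤ e) : polyCurve K F e ≤ polyCurve K F d :=
  Submodule.span_mono fun _ ⟨k, hk, c, hc⟩ => ⟨k, h.trans hk, c, hc⟩

theorem map_mem_polyCurve {d : ℕ} (L : F →ₗ[K] G) {g : K → F} (hg : g ∈ polyCurve K F d) :
    (fun t => L (g t)) ∈ polyCurve K G d := by
  induction hg using Submodule.span_induction with
  | mem g h =>
    obtain ⟨k, hk, c, rfl⟩ := h
    simpa using monomial_mem_polyCurve hk (L c)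
  | zero =>
    simp only [Pi.zero_apply, map_zero]
    exact zero_mem _
  | add g h _ _ hg hh =>
    simp only [Pi.add_apply, map_add]
    exact add_mem hg hh
  | smul a g _ hg =>
    simp only [Pi.smul_apply, map_smul]
    exact (polyCurve K G d).smul_mem a hg

theorem pow_smul_mem_polyCurve {d : ℕ} (k : ℕ) {g : K → F} (hg : g ∈ polyCurve K F d) :
    (fun t => t ^ k • g t) ∈ polyCurve K F (k + d) := by
  induction hg using Submodule.span_induction with
  | mem g h =>
    obtain ⟨l, hl, c, rfl⟩ := h
    simpa [smul_smul, ← pow_add] using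
      monomial_mem_polyCurve (K := K) (Nat.add_le_add_left hl k) c
  | zero =>
    simp only [Pi.zero_apply, smul_zero]
    exact zero_mem _
  | add g h _ _ hg hh =>
    simp only [Pi.add_apply, smul_add]
    exact add_mem hg hh
  | smul a g _ hg =>
    simp only [Pi.smul_apply, smul_comm _ a]
    exact (polyCurve K F (k + d)).smul_mem a hg

theorem bilin_mem_polyCurve {d e : ℕ} (L : E →ₗ[K] F →ₗ[K] G) {f : K → E} {g : K → F}
    (hf : f ∈ polyCurve K E d) (hg : g ∈ polyCurve K F e) :
    (fun t => L (f t) (g t)) ∈ polyCurve K G (d + e) := by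
  induction hf using Submodule.span_induction with
  | mem f h =>
    obtain ⟨k, hk, c, rfl⟩ := h
    simpa using polyCurve_antitone (Nat.add_le_add_right hk e)
      (pow_smul_mem_polyCurve k (map_mem_polyCurve (L c) hg))
  | zero =>
    simp only [Pi.zero_apply, map_zero, LinearMap.zero_apply]
    exact zero_mem _
  | add f h _ _ hf hh =>
    simp only [Pi.add_apply, map_add, LinearMap.add_apply]
    exact add_mem hf hh
  | smul a f _ hf =>
    simp only [Pi.smul_apply, map_smul, LinearMap.smul_apply]
    exact (polyCurve K G (d + e)).smul_mem a hf

theorem multilinear_mem_polyCurve {m : ℕ} (u : MultilinearMap K (fun _ : Fin m => E) F)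
    (d : Fin m → ℕ) (g : Fin m → K → E) (hg : ∀ i, g i ∈ polyCurve K E (d i)) :
    (fun t => u fun i => g i t) ∈ polyCurve K F (∑ i, d i) := by
  induction m with
  | zero =>
    have : (fun t => u fun i => g i t) = fun _ => u fun i => i.elim0 := by
      funext t; congr 1; funext i; exact i.elim0
    rw [this]
    simpa using const_mem_polyCurve _
  | succ m ih =>
    have key : ∀ f : K → E, f ∈ polyCurve K E (d 0) →
        (fun t => u.curryLeft (f t) fun i => g i.succ t) ∈ polyCurve K F (∑ i, d i) := by
      intro f hf
      induction hf using Submodule.span_induction with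
      | mem f h =>
        obtain ⟨k, hk, c, rfl⟩ := h
        have := pow_smul_mem_polyCurve k (ih (u.curryLeft c) (fun i => d i.succ)
          (fun i => g i.succ) fun i => hg i.succ)
        rw [Fin.sum_univ_succ]
        simpa using polyCurve_antitone (Nat.add_le_add_right hk _) this
      | zero =>
        simp only [Pi.zero_apply, map_zero, zero_apply]
        exact zero_mem _
      | add f h _ _ hf hh =>
        simp only [Pi.add_apply, map_add, add_apply]
        exact add_mem hf hh
      | smul a f _ hf =>
        simp only [Pi.smul_apply, map_smul, smul_apply]
        exact (polyCurve K F (∑ i, d i)).smul_mem a hf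
    convert key (g 0) (hg 0) using 1
    funext t
    rw [MultilinearMap.curryLeft_apply]
    congr 1
    funext i
    refine Fin.cases ?_ (fun j => ?_) i <;> simp

/-- After a linear functional is applied, the curve becomes a polynomial function; `K` is infinite,
so its values determine the coefficient of `t`. -/
theorem eq_zero_of_linear_mem_polyCurve [CharZero K] {w : F}
    (h : (fun t : K => t • w) ∈ polyCurve K F 2) : w = 0 := by
  refine (Module.forall_dual_apply_eq_zero_iff K _).1 fun ψ => ?_
  have key : ∀ g ∈ polyCurve K F 2, ∃ P : Polynomial K, P.coeff 1 = 0 ∧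
      ∀ t, P.eval t = ψ (g t) := by
    intro g hg
    induction hg using Submodule.span_induction with
    | mem g h =>
      obtain ⟨k, hk, c, rfl⟩ := h
      refine ⟨Polynomial.monomial k (ψ c), ?_, fun t => by simp [mul_comm]⟩
      rw [Polynomial.coeff_monomial, if_neg (by omega)]
    | zero => exact ⟨0, by simp, by simp⟩
    | add g h _ _ hg hh =>
      obtain ⟨P, hP, hP'⟩ := hg
      obtain ⟨Q, hQ, hQ'⟩ := hh
      exact ⟨P + Q, by simp [hP, hQ], by simp [hP', hQ']⟩
    | smul a g _ hg =>
      obtain ⟨P, hP, hP'⟩ := hg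
      exact ⟨a • P, by simp [hP], by simp [hP']⟩
  obtain ⟨P, hP, hP'⟩ := key _ h
  have : P = Polynomial.monomial 1 (ψ w) := Polynomial.funext fun t => by
    simp [hP', mul_comm]
  rw [this] at hP
  simpa using hP

variable (K) in
/-- `w` is the derivative of `f` at `x` in direction `v`, in the sense that
`f (x + t v) = f x + t w` up to a polynomial in `t` divisible by `t ^ 2`. -/
def HasFormalDeriv (f : E → F) (x v : E) (w : F) : Prop :=
  (fun t : K => f (x + t • v) - f x - t • w) ∈ polyCurve K F 2

/-- Uniqueness lets a derivative be computed from any expression for the map, without a multilinear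
map that determines it. -/
theorem HasFormalDeriv.unique [CharZero K] {f : E → F} {x v : E} {w w' : F}
    (h : HasFormalDeriv K f x v w) (h' : HasFormalDeriv K f x v w') : w = w' := by
  rw [← sub_eq_zero]
  refine eq_zero_of_linear_mem_polyCurve (K := K) ?_
  convert sub_mem h' h using 1
  funext t
  simp [smul_sub]

theorem HasFormalDeriv.sub_mem {f : E → F} {x v : E} {w : F} (h : HasFormalDeriv K f x v w) :
    (fun t : K => f (x + t • v) - f x) ∈ polyCurve K F 1 := by
  convert add_mem (polyCurve_antitone one_le_two h) (linear_mem_polyCurve w) using 1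
  funext t
  simp

theorem hasFormalDeriv_const (c : F) (x v : E) : HasFormalDeriv K (fun _ => c) x v 0 := by
  unfold HasFormalDeriv
  convert (polyCurve K F 2).zero_mem using 1
  funext t
  simp

theorem hasFormalDeriv_linear (L : E →ₗ[K] F) (x v : E) :
    HasFormalDeriv K (fun y => L y) x v (L v) := by
  unfold HasFormalDeriv
  convert (polyCurve K F 2).zero_mem using 1
  funext t
  simp

theorem HasFormalDeriv.sum {ι : Type*} {S : Finset ι} {f : ι → E → F} {x v : E} {w : ι → F}
    (h : ∀ i ∈ S, HasFormalDeriv K (f i) x v (w i)) :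
    HasFormalDeriv K (fun y => ∑ i ∈ S, f i y) x v (∑ i ∈ S, w i) := by
  unfold HasFormalDeriv
  convert Submodule.sum_mem _ h using 1
  funext t
  simp [Finset.smul_sum]

theorem HasFormalDeriv.add {f g : E → F} {x v : E} {w w' : F} (hf : HasFormalDeriv K f x v w)
    (hg : HasFormalDeriv K g x v w') : HasFormalDeriv K (fun y => f y + g y) x v (w + w') := by
  unfold HasFormalDeriv
  convert add_mem hf hg using 1
  funext t
  simp
  abel

theorem HasFormalDeriv.map (L : F →ₗ[K] G) {f : E → F} {x v : E} {w : F}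
    (h : HasFormalDeriv K f x v w) : HasFormalDeriv K (fun y => L (f y)) x v (L w) := by
  simpa [HasFormalDeriv] using map_mem_polyCurve L h

theorem HasFormalDeriv.bilin {F' : Type*} [AddCommGroup F'] [Module K F']
    (L : F →ₗ[K] F' →ₗ[K] G) {f : E → F} {g : E → F'} {x v : E} {w : F} {w' : F'}
    (hf : HasFormalDeriv K f x v w) (hg : HasFormalDeriv K g x v w') :
    HasFormalDeriv K (fun y => L (f y) (g y)) x v (L w (g x) + L (f x) w') := by
  -- With increments `Δf`, `Δg`, the error is `L Δf Δg + L (f x) (Δg - t w') + L (Δf - t w) (g x)`.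
  have h1 := bilin_mem_polyCurve L hf.sub_mem hg.sub_mem
  have h2 := map_mem_polyCurve (L (f x)) hg
  have h3 := map_mem_polyCurve (L.flip (g x)) hf
  unfold HasFormalDeriv
  convert add_mem (add_mem h1 h2) h3 using 1
  funext t
  simp
  abel

theorem HasFormalDeriv.lie {A : Type*} [LieRing A] [LieAlgebra K A] {f g : E → A} {x v : E}
    {w w' : A} (hf : HasFormalDeriv K f x v w) (hg : HasFormalDeriv K g x v w') :
    HasFormalDeriv K (fun y => ⁅f y, g y⁆) x v (⁅w, g x⁆ + ⁅f x, w'⁆) :=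
  hf.bilin (LieModule.toEnd K A A : A →ₗ[K] A →ₗ[K] A) hg

/-- In the expansion of `u` at the increments `Δa i`, terms with at least two increments are
divisible by `t ^ 2`; in the linear part each `Δa i` may be replaced by `t • w i`. -/
theorem HasFormalDeriv.multilinear {m : ℕ} {E' : Type*} [AddCommGroup E'] [Module K E']
    (u : MultilinearMap K (fun _ : Fin m => E) F) {a : Fin m → E' → E} {x v : E'}
    {w : Fin m → E} (h : ∀ i, HasFormalDeriv K (a i) x v (w i)) :
    HasFormalDeriv K (fun y => u fun i => a i y) x v
      (∑ i, u (Function.update (fun j => a j x) i (w i))) := by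
  have h1 : (fun t : K => u.linearDeriv (fun j => a j x)
      (fun i => a i (x + t • v) - a i x - t • w i)) ∈ polyCurve K F 2 := by
    simp only [MultilinearMap.linearDeriv_apply]
    have := Submodule.sum_mem (polyCurve K F 2) (t := Finset.univ) fun i _ =>
      map_mem_polyCurve (u.toLinearMap (fun j => a j x) i) (h i)
    convert this using 1
    funext t
    simp
  have h2 : (fun t : K => ∑ s : Finset (Fin m) with 2 ≤ s.card,
      u (s.piecewise (fun i => a i (x + t • v) - a i x) (fun j => a j x))) ∈ polyCurve K F 2 := by
    have := Submodule.sum_mem (polyCurve K F 2)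
      (t := (Finset.univ.filter fun s : Finset (Fin m) => 2 ≤ s.card))
      (f := fun s t => u (s.piecewise (fun i => a i (x + t • v) - a i x) (fun j => a j x))) ?_
    · convert this using 1
      funext t
      simp
    · intro s hs
      have hs2 : 2 ≤ ∑ i, if i ∈ s then 1 else 0 := by
        simpa using hs
      refine polyCurve_antitone hs2 ?_
      refine multilinear_mem_polyCurve u _
        (fun i t => s.piecewise (fun i => a i (x + t • v) - a i x) (fun j => a j x) i) fun i => ?_
      by_cases hi : i ∈ s
      · simpa [hi] using (h i).sub_mem
      · simpa [hi] using const_mem_polyCurve _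
  unfold HasFormalDeriv
  convert add_mem h1 h2 using 1
  funext t
  have h3 := u.map_add_eq_map_add_linearDeriv_add (fun j => a j x)
    (fun i => a i (x + t • v) - a i x)
  have h4 : ((fun j => a j x) + fun i => a i (x + t • v) - a i x) = fun i => a i (x + t • v) := by
    funext i; simp
  have h5 : (fun i => a i (x + t • v) - a i x - t • w i) =
      (fun i => a i (x + t • v) - a i x) - t • w := rfl
  rw [h4] at h3
  rw [Pi.add_apply]
  beta_reduce
  rw [h3, h5, map_sub, map_smul]
  simp only [MultilinearMap.linearDeriv_apply u _ w]
  abel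

end FormalDeriv

/-! ### Reindexing of sums over triples of degrees. -/

section TripleSums

variable {M : Type*} [AddCommMonoid M]

theorem sum_antidiagonal_antidiagonal_assoc (s : ℕ) (T : ℕ → ℕ → ℕ → M) :
    ∑ p ∈ antidiagonal s, ∑ q ∈ antidiagonal p.1, T q.1 q.2 p.2 =
      ∑ p ∈ antidiagonal s, ∑ q ∈ antidiagonal p.2, T p.1 q.1 q.2 := by
  rw [Finset.sum_sigma', Finset.sum_sigma']
  refine Finset.sum_nbij' (fun a => ⟨(a.2.1, a.2.2 + a.1.2), (a.2.2, a.1.2)⟩)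
    (fun a => ⟨(a.1.1 + a.2.1, a.2.2), (a.1.1, a.2.1)⟩) ?_ ?_ ?_ ?_ ?_
  all_goals
    rintro ⟨⟨a, b⟩, ⟨c, d⟩⟩ h0
    simp only [Finset.mem_sigma, mem_antidiagonal] at h0
    obtain ⟨h1, h2⟩ := h0
    subst h2
    subst h1
    simp [add_assoc]

theorem sum_antidiagonal_antidiagonal_left_comm (s : ℕ) (T : ℕ → ℕ → ℕ → M) :
    ∑ p ∈ antidiagonal s, ∑ q ∈ antidiagonal p.2, T p.1 q.1 q.2 =
      ∑ p ∈ antidiagonal s, ∑ q ∈ antidiagonal p.2, T q.1 p.1 q.2 := by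
  rw [Finset.sum_sigma', Finset.sum_sigma']
  refine Finset.sum_nbij' (fun a => ⟨(a.2.1, a.1.1 + a.2.2), (a.1.1, a.2.2)⟩)
    (fun a => ⟨(a.2.1, a.1.1 + a.2.2), (a.1.1, a.2.2)⟩) ?_ ?_ ?_ ?_ ?_
  all_goals
    rintro ⟨⟨a, b⟩, ⟨c, d⟩⟩ h0
    simp only [Finset.mem_sigma, mem_antidiagonal] at h0
    obtain ⟨h1, h2⟩ := h0
    subst h2
    subst h1
    simp [add_left_comm]

end TripleSums

/-! ### First and second derivatives of homogeneous polynomials. -/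

section DirDeriv

variable {K : Type*} [Field K]
variable {E : Type*} [AddCommGroup E] [Module K E]
variable {F : Type*} [AddCommGroup F] [Module K F]
variable {G : Type*} [AddCommGroup G] [Module K G]

/-- The derivative at `x` of a homogeneous polynomial, as a linear function of the direction. -/
def dirDeriv {m : ℕ} (f : homPoly K E F m) (x : E) : E →ₗ[K] F :=
  ∑ i, f.2.choose.toLinearMap (fun _ => x) i

theorem dirDeriv_apply {m : ℕ} (f : homPoly K E F m) (x v : E) :
    dirDeriv f x v = ∑ i, f.2.choose (Function.update (fun _ => x) i v) := by
  simp [dirDeriv]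

theorem polyDeriv_eq_dirDeriv {r m : ℕ} (ξ : homPoly K E E r) (f : homPoly K E F m) (x : E) :
    polyDeriv ξ f x = dirDeriv f x (ξ.1 x) :=
  (dirDeriv_apply f x _).symm

theorem hasFormalDeriv_homPoly {m : ℕ} (f : homPoly K E F m) (x v : E) :
    HasFormalDeriv K f.1 x v (dirDeriv f x v) := by
  have h := HasFormalDeriv.multilinear f.2.choose (a := fun _ y => y) (w := fun _ => v) fun _ =>
    hasFormalDeriv_linear LinearMap.id x v
  rw [dirDeriv_apply]
  convert h using 1
  exact funext f.2.choose_spec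

/-- This removes the arbitrary choice in `dirDeriv`: all later derivatives are found by the product
rules for `HasFormalDeriv`. -/
theorem dirDeriv_eq [CharZero K] {m : ℕ} {f : homPoly K E F m} {g : E → F} (h : ∀ y, f.1 y = g y)
    {x v : E} {w : F} (hg : HasFormalDeriv K g x v w) : dirDeriv f x v = w := by
  have h1 := hasFormalDeriv_homPoly f x v
  rw [funext h] at h1
  exact h1.unique hg

theorem dirDeriv_of_degree_zero (f : homPoly K E F 0) (x : E) : dirDeriv f x = 0 := by
  simp [dirDeriv]

theorem dirDeriv_add [CharZero K] {m : ℕ} (f g : homPoly K E F m) (x v : E) :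
    dirDeriv (f + g) x v = dirDeriv f x v + dirDeriv g x v :=
  dirDeriv_eq (fun _ => rfl) ((hasFormalDeriv_homPoly f x v).add (hasFormalDeriv_homPoly g x v))

theorem dirDeriv_smul [CharZero K] {m : ℕ} (c : K) (f : homPoly K E F m) (x v : E) :
    dirDeriv (c • f) x v = c • dirDeriv f x v :=
  dirDeriv_eq (fun _ => rfl) ((hasFormalDeriv_homPoly f x v).map (c • LinearMap.id))

/-- The second derivative of a homogeneous polynomial at `x` in the directions `v` and `w`. -/
def secondDeriv {m : ℕ} (f : homPoly K E F m) (x v w : E) : F :=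
  ∑ i, ∑ j with j ≠ i, f.2.choose (Function.update (Function.update (fun _ => x) i v) j w)

theorem secondDeriv_comm {m : ℕ} (f : homPoly K E F m) (x v w : E) :
    secondDeriv f x v w = secondDeriv f x w v := by
  simp only [secondDeriv, Finset.sum_filter]
  rw [Finset.sum_comm]
  refine Finset.sum_congr rfl fun i _ => Finset.sum_congr rfl fun j _ => ?_
  by_cases h : j = i
  · simp [h]
  · rw [if_pos (Ne.symm h), if_pos h, Function.update_comm h]

theorem secondDeriv_of_degree_le_one {m : ℕ} (hm : m ≤ 1) (f : homPoly K E F m) (x v w : E) :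
    secondDeriv f x v w = 0 := by
  refine Finset.sum_eq_zero fun i _ => Finset.sum_eq_zero fun j hj => ?_
  have := (Finset.mem_filter.1 hj).2
  omega

/-- In each term `ξ y` fills slot `i` and `y` the others. Differentiating slot `i` gives the
first-order part, and differentiating another slot gives `secondDeriv`. -/
theorem HasFormalDeriv.dirDeriv {m : ℕ} (f : homPoly K E F m) {ξ : E → E} {x v w : E}
    (h : HasFormalDeriv K ξ x v w) :
    HasFormalDeriv K (fun y => LieWreath.dirDeriv f y (ξ y)) x v
      (secondDeriv f x (ξ x) v + LieWreath.dirDeriv f x w) := by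
  have key : ∀ i, HasFormalDeriv K
      (fun y => f.2.choose fun j => Function.update (fun _ => y) i (ξ y) j) x v
      (∑ j, f.2.choose (Function.update (Function.update (fun _ => x) i (ξ x)) j
        (Function.update (fun _ => v) i w j))) := by
    intro i
    refine HasFormalDeriv.multilinear f.2.choose fun j => ?_
    by_cases hj : j = i
    · subst hj; simpa using h
    · simpa [hj] using hasFormalDeriv_linear LinearMap.id x v
  have h2 := HasFormalDeriv.sum (S := Finset.univ) fun i _ => key i
  simp only [dirDeriv_apply, secondDeriv]
  convert h2 using 1
  rw [← Finset.sum_add_distrib]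
  refine Finset.sum_congr rfl fun i _ => ?_
  rw [← Finset.add_sum_erase _ _ (Finset.mem_univ i), add_comm, ← Finset.filter_ne']
  congr 1
  · simp
  · refine Finset.sum_congr rfl fun j hj => ?_
    rw [Function.update_of_ne (Finset.mem_filter.1 hj).2]

end DirDeriv

/-! ### Formal vector fields as derivations, and their commutators. -/

section Along

variable {K : Type*} [Field K]
variable {E : Type*} [AddCommGroup E] [Module K E]
variable {F : Type*} [AddCommGroup F] [Module K F]
variable {G : Type*} [AddCommGroup G] [Module K G]

/-- The constant component of `f` contributes nothing, so the degrees `r + m = s + 1` with `m ≥ 1`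
are indexed by `antidiagonal s`. -/
theorem Series.along_val_dirDeriv (ξ : Series K E E) (f : Series K E F) (s : ℕ) (x : E) :
    ((ξ.along f) s).1 x = ∑ p ∈ antidiagonal s, dirDeriv (f (p.2 + 1)) x ((ξ p.1).1 x) := by
  rw [Series.along_val, Finset.Nat.sum_antidiagonal_succ']
  simp only [polyDeriv_eq_dirDeriv]
  rw [dirDeriv_of_degree_zero, LinearMap.zero_apply, zero_add]

theorem Series.add_along (ξ η : Series K E E) (f : Series K E F) :
    (ξ + η).along f = ξ.along f + η.along f :=
  Series.ext fun s x => by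
    simp only [Series.add_val, Series.along_val_dirDeriv, ← Finset.sum_add_distrib, map_add]

theorem Series.smul_along (c : K) (ξ : Series K E E) (f : Series K E F) :
    (c • ξ).along f = c • ξ.along f :=
  Series.ext fun s x => by
    simp only [Series.smul_val, Series.along_val_dirDeriv, Finset.smul_sum, map_smul]

theorem Series.sub_along (ξ η : Series K E E) (f : Series K E F) :
    (ξ - η).along f = ξ.along f - η.along f := by
  rw [eq_sub_iff_add_eq, ← Series.add_along, sub_add_cancel]

/-- Composition of a series with a linear map. -/
def Series.map (L : F →ₗ[K] G) (f : Series K E F) : Series K E G := fun m =>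
  ⟨fun x => L ((f m).1 x), by
    obtain ⟨u, hu⟩ := (f m).2
    exact ⟨L.compMultilinearMap u, fun x => by simp [hu]⟩⟩

@[simp] theorem Series.map_val (L : F →ₗ[K] G) (f : Series K E F) (m : ℕ) (x : E) :
    ((f.map L) m).1 x = L ((f m).1 x) := rfl

variable [CharZero K]

theorem Series.along_add (ξ : Series K E E) (f g : Series K E F) :
    ξ.along (f + g) = ξ.along f + ξ.along g :=
  Series.ext fun s x => by
    simp only [Series.add_val, Series.along_val_dirDeriv, ← Finset.sum_add_distrib]
    exact Finset.sum_congr rfl fun p _ => dirDeriv_add _ _ _ _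

theorem Series.along_smul (ξ : Series K E E) (c : K) (f : Series K E F) :
    ξ.along (c • f) = c • ξ.along f :=
  Series.ext fun s x => by
    simp only [Series.smul_val, Series.along_val_dirDeriv, Finset.smul_sum]
    exact Finset.sum_congr rfl fun p _ => dirDeriv_smul _ _ _ _

theorem Series.along_sub (ξ : Series K E E) (f g : Series K E F) :
    ξ.along (f - g) = ξ.along f - ξ.along g := by
  rw [eq_sub_iff_add_eq, ← Series.along_add, sub_add_cancel]

/-- The derivative along a series is a derivation of the Lie algebra `A[[E]]`. -/
theorem Series.along_lie {A : Type*} [LieRing A] [LieAlgebra K A] (ξ : Series K E E)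
    (f g : Series K E A) : ξ.along ⁅f, g⁆ = ⁅ξ.along f, g⁆ + ⁅f, ξ.along g⁆ :=
  Series.ext fun s x => by
    have h1 : ∀ m v, dirDeriv (⁅f, g⁆ m) x v = ∑ p ∈ antidiagonal m,
        (⁅dirDeriv (f p.1) x v, (g p.2).1 x⁆ + ⁅(f p.1).1 x, dirDeriv (g p.2) x v⁆) := fun m v =>
      dirDeriv_eq (fun y => Series.lie_val f g m y) <| HasFormalDeriv.sum fun p _ =>
        (hasFormalDeriv_homPoly (f p.1) x v).lie (hasFormalDeriv_homPoly (g p.2) x v)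
    have h2 : ∀ m v, dirDeriv (⁅f, g⁆ (m + 1)) x v =
        ∑ p ∈ antidiagonal m, ⁅dirDeriv (f (p.1 + 1)) x v, (g p.2).1 x⁆ +
        ∑ p ∈ antidiagonal m, ⁅(f p.1).1 x, dirDeriv (g (p.2 + 1)) x v⁆ := by
      intro m v
      rw [h1, Finset.sum_add_distrib, Finset.Nat.sum_antidiagonal_succ,
        Finset.Nat.sum_antidiagonal_succ']
      simp [dirDeriv_of_degree_zero]
    simp only [Series.add_val, Series.lie_val, Series.along_val_dirDeriv, h2, sum_lie, lie_sum]
    rw [Finset.sum_add_distrib,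
      sum_antidiagonal_antidiagonal_assoc s fun a b c =>
        ⁅dirDeriv (f (b + 1)) x ((ξ a).1 x), (g c).1 x⁆,
      sum_antidiagonal_antidiagonal_left_comm s fun a b c =>
        ⁅(f b).1 x, dirDeriv (g (c + 1)) x ((ξ a).1 x)⁆]

/-- The second-order and first-order parts of an iterated derivative of a series. -/
theorem Series.along_along_val (ξ η : Series K E E) (f : Series K E F) (s : ℕ) (x : E) :
    ((ξ.along (η.along f)) s).1 x = ∑ p ∈ antidiagonal s, ∑ q ∈ antidiagonal p.2,
      secondDeriv (f (q.2 + 2)) x ((η q.1).1 x) ((ξ p.1).1 x) +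
      (((ξ.along η).along f) s).1 x := by
  have h1 : ∀ m v, dirDeriv ((η.along f) m) x v = ∑ q ∈ antidiagonal m,
      (secondDeriv (f (q.2 + 1)) x ((η q.1).1 x) v +
        dirDeriv (f (q.2 + 1)) x (dirDeriv (η q.1) x v)) := fun m v =>
    dirDeriv_eq (fun y => Series.along_val_dirDeriv η f m y) <| HasFormalDeriv.sum fun q _ =>
      (hasFormalDeriv_homPoly (η q.1) x v).dirDeriv (f (q.2 + 1))
  have h2 : ∀ m v, dirDeriv ((η.along f) (m + 1)) x v =
      ∑ q ∈ antidiagonal m, secondDeriv (f (q.2 + 2)) x ((η q.1).1 x) v +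
      ∑ q ∈ antidiagonal m, dirDeriv (f (q.2 + 1)) x (dirDeriv (η (q.1 + 1)) x v) := by
    intro m v
    rw [h1, Finset.sum_add_distrib, Finset.Nat.sum_antidiagonal_succ',
      Finset.Nat.sum_antidiagonal_succ]
    simp [dirDeriv_of_degree_zero, secondDeriv_of_degree_le_one]
  rw [Series.along_val_dirDeriv]
  simp only [h2]
  rw [Finset.sum_add_distrib, Series.along_val_dirDeriv (ξ.along η)]
  simp only [Series.along_val_dirDeriv, map_sum]
  rw [sum_antidiagonal_antidiagonal_assoc s fun a b c =>
    dirDeriv (f (c + 1)) x (dirDeriv (η (b + 1)) x ((ξ a).1 x))]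

/-- The second-order parts of the two iterated derivatives agree by symmetry of `secondDeriv`; only
the first-order parts survive. -/
theorem Series.along_commutator (ξ η : Series K E E) (f : Series K E F) :
    (ξ.along η - η.along ξ).along f = ξ.along (η.along f) - η.along (ξ.along f) := by
  have h : ξ.along (η.along f) + (η.along ξ).along f =
      η.along (ξ.along f) + (ξ.along η).along f := by
    refine Series.ext fun s x => ?_
    simp only [Series.add_val, Series.along_along_val]
    rw [sum_antidiagonal_antidiagonal_left_comm s fun a b c =>
      secondDeriv (f (c + 2)) x ((η b).1 x) ((ξ a).1 x)]
    simp only [fun a b c => secondDeriv_comm (f c) x ((η a).1 x) ((ξ b).1 x)]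
    abel
  rw [Series.sub_along, sub_eq_sub_iff_add_eq_add, add_comm, ← h, add_comm]

theorem Series.along_map (ξ : Series K E E) (L : F →ₗ[K] G) (f : Series K E F) :
    ξ.along (f.map L) = (ξ.along f).map L :=
  Series.ext fun s x => by
    simp only [Series.map_val, Series.along_val_dirDeriv, map_sum]
    exact Finset.sum_congr rfl fun p _ =>
      dirDeriv_eq (fun _ => rfl) ((hasFormalDeriv_homPoly (f (p.2 + 1)) x _).map L)

end Along

/-! ### Recursions and derivatives for `e^{ad z}` and `φ(ad z)`, degree by degree. -/

section AdSeries

variable {K : Type*} [Field K]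
variable {C : Type*} [LieRing C] [LieAlgebra K C]

variable (K) in
/-- The component of degree `n` of `e ^ (ad z) c`. -/
def expAd (z c : C) (n : ℕ) : C := ((n ! : ℕ) : K)⁻¹ • (LieAlgebra.ad K C z ^ n) c

variable (K) in
/-- The component of degree `n` of `((e ^ (ad z) - 1) / ad z) v`. -/
def phiAd (z v : C) (n : ℕ) : C := (((n + 1)! : ℕ) : K)⁻¹ • (LieAlgebra.ad K C z ^ n) v

@[simp] theorem expAd_zero (z c : C) : expAd K z c 0 = c := by simp [expAd]

@[simp] theorem phiAd_zero (z v : C) : phiAd K z v 0 = v := by simp [phiAd]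

theorem phiAd_add (z v w : C) (n : ℕ) : phiAd K z (v + w) n = phiAd K z v n + phiAd K z w n := by
  simp [phiAd]

theorem phiAd_sum {ι : Type*} (S : Finset ι) (z : C) (v : ι → C) (n : ℕ) :
    phiAd K z (∑ i ∈ S, v i) n = ∑ i ∈ S, phiAd K z (v i) n := by
  simp [phiAd, Finset.smul_sum]

variable (K) in
/-- The derivative of `z ↦ phiAd z v n` in the direction `w`. -/
def phiAdDeriv (z w v : C) : ℕ → C
  | 0 => 0
  | n + 1 => ((n + 2 : ℕ) : K)⁻¹ • (⁅w, phiAd K z v n⁆ + ⁅z, phiAdDeriv z w v n⁆)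

theorem phiAdDeriv_succ (z w v : C) (n : ℕ) : phiAdDeriv K z w v (n + 1) =
    ((n + 2 : ℕ) : K)⁻¹ • (⁅w, phiAd K z v n⁆ + ⁅z, phiAdDeriv K z w v n⁆) := rfl

variable [CharZero K]

theorem expAd_succ (z c : C) (n : ℕ) :
    ((n + 1 : ℕ) : K) • expAd K z c (n + 1) = ⁅z, expAd K z c n⁆ := by
  have h : ((n + 1 : ℕ) : K) ≠ 0 := Nat.cast_ne_zero.2 n.succ_ne_zero
  rw [expAd, expAd, smul_smul, Nat.factorial_succ, Nat.cast_mul, mul_inv, mul_inv_cancel_left₀ h,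
    lie_smul, pow_succ']
  rfl

theorem phiAd_succ (z v : C) (n : ℕ) :
    ((n + 2 : ℕ) : K) • phiAd K z v (n + 1) = ⁅z, phiAd K z v n⁆ := by
  have h : ((n + 2 : ℕ) : K) ≠ 0 := Nat.cast_ne_zero.2 (n + 1).succ_ne_zero
  rw [phiAd, phiAd, smul_smul, Nat.factorial_succ (n + 1), Nat.cast_mul, mul_inv,
    mul_inv_cancel_left₀ h, lie_smul, pow_succ']
  rfl

/-- The weight `n + 2 = (p.1 + 1) + p.2` is split between the factors; each share turns its factor
into a bracket with `z`, and the Jacobi identity collects them. The term `p.1 = 0` leaves `⁅w, _⁆`.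
-/
theorem smul_sum_phiAd_expAd (z w c : C) (n : ℕ) :
    ((n + 2 : ℕ) : K) • ∑ p ∈ antidiagonal (n + 1), ⁅phiAd K z w p.1, expAd K z c p.2⁆ =
      ⁅w, expAd K z c (n + 1)⁆ +
        ⁅z, ∑ p ∈ antidiagonal n, ⁅phiAd K z w p.1, expAd K z c p.2⁆⁆ := by
  have h : ∀ p ∈ antidiagonal (n + 1),
      ((n + 2 : ℕ) : K) • ⁅phiAd K z w p.1, expAd K z c p.2⁆ =
      ⁅((p.1 + 1 : ℕ) : K) • phiAd K z w p.1, expAd K z c p.2⁆ +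
      ⁅phiAd K z w p.1, (p.2 : K) • expAd K z c p.2⁆ := by
    intro p hp
    have hn : n + 2 = p.1 + 1 + p.2 := by
      have := mem_antidiagonal.1 hp
      omega
    rw [hn, smul_lie, lie_smul, ← add_smul, ← Nat.cast_add]
  rw [Finset.smul_sum, Finset.sum_congr rfl h, Finset.sum_add_distrib,
    Finset.Nat.sum_antidiagonal_succ, Finset.Nat.sum_antidiagonal_succ']
  simp only [add_assoc, one_add_one_eq_two, phiAd_succ, expAd_succ, phiAd_zero]
  simp [lie_sum]

theorem smul_sum_phiAd_phiAd (z w v : C) (n : ℕ) :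
    ((n + 3 : ℕ) : K) • ∑ p ∈ antidiagonal (n + 1), ⁅phiAd K z w p.1, phiAd K z v p.2⁆ =
      ⁅w, phiAd K z v (n + 1)⁆ + ⁅phiAd K z w (n + 1), v⁆ +
        ⁅z, ∑ p ∈ antidiagonal n, ⁅phiAd K z w p.1, phiAd K z v p.2⁆⁆ := by
  have h : ∀ p ∈ antidiagonal (n + 1),
      ((n + 3 : ℕ) : K) • ⁅phiAd K z w p.1, phiAd K z v p.2⁆ =
      ⁅((p.1 + 1 : ℕ) : K) • phiAd K z w p.1, phiAd K z v p.2⁆ +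
      ⁅phiAd K z w p.1, ((p.2 + 1 : ℕ) : K) • phiAd K z v p.2⁆ := by
    intro p hp
    have hn : n + 3 = p.1 + 1 + (p.2 + 1) := by
      have := mem_antidiagonal.1 hp
      omega
    rw [hn, smul_lie, lie_smul, ← add_smul, ← Nat.cast_add]
  rw [Finset.smul_sum, Finset.sum_congr rfl h, Finset.sum_add_distrib,
    Finset.Nat.sum_antidiagonal_succ, Finset.Nat.sum_antidiagonal_succ']
  simp only [add_assoc, one_add_one_eq_two, phiAd_succ, phiAd_zero]
  simp only [lie_sum, leibniz_lie z, Finset.sum_add_distrib]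
  simp
  abel

theorem sum_expAd_lie_expAd (z c c' : C) (n : ℕ) :
    ∑ p ∈ antidiagonal n, ⁅expAd K z c p.1, expAd K z c' p.2⁆ = expAd K z ⁅c, c'⁆ n := by
  induction n with
  | zero => simp
  | succ n ih =>
    have h0 : ((n + 1 : ℕ) : K) ≠ 0 := Nat.cast_ne_zero.2 n.succ_ne_zero
    refine smul_right_injective C h0 ?_
    beta_reduce
    rw [expAd_succ, ← ih]
    have h : ∀ p ∈ antidiagonal (n + 1),
        ((n + 1 : ℕ) : K) • ⁅expAd K z c p.1, expAd K z c' p.2⁆ =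
        ⁅(p.1 : K) • expAd K z c p.1, expAd K z c' p.2⁆ +
        ⁅expAd K z c p.1, (p.2 : K) • expAd K z c' p.2⁆ := by
      intro p hp
      have hn : n + 1 = p.1 + p.2 := by
        have := mem_antidiagonal.1 hp
        omega
      rw [hn, smul_lie, lie_smul, ← add_smul, ← Nat.cast_add]
    rw [Finset.smul_sum, Finset.sum_congr rfl h, Finset.sum_add_distrib,
      Finset.Nat.sum_antidiagonal_succ, Finset.Nat.sum_antidiagonal_succ']
    simp only [expAd_succ]
    simp [lie_sum]

/-- This is the Maurer-Cartan equation for constant directions `w`, `v`: both sides satisfy the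
recursion `smul_sum_phiAd_phiAd`. -/
theorem phiAdDeriv_sub_phiAdDeriv (z w v : C) (n : ℕ) :
    phiAdDeriv K z w v (n + 1) - phiAdDeriv K z v w (n + 1) =
      ∑ p ∈ antidiagonal n, ⁅phiAd K z w p.1, phiAd K z v p.2⁆ := by
  induction n with
  | zero =>
    have h : ((0 + 2 : ℕ) : K) ≠ 0 := by norm_num
    rw [phiAdDeriv_succ, phiAdDeriv_succ z v, ← smul_sub, inv_smul_eq_iff₀ h]
    simp only [phiAdDeriv, phiAd_zero, lie_zero, add_zero, Finset.Nat.antidiagonal_zero,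
      Finset.sum_singleton]
    rw [← lie_skew v w, sub_neg_eq_add, zero_add, Nat.cast_ofNat, two_smul]
  | succ n ih =>
    have h : ((n + 3 : ℕ) : K) ≠ 0 := Nat.cast_ne_zero.2 (by omega)
    rw [phiAdDeriv_succ, phiAdDeriv_succ z v, ← smul_sub, inv_smul_eq_iff₀ h, smul_sum_phiAd_phiAd, ← ih,
      lie_sub, ← lie_skew v]
    abel

variable {E : Type*} [AddCommGroup E] [Module K E]

/-- Differentiating `expAd_succ` yields the recursion `smul_sum_phiAd_expAd` for the right-hand
side. -/
theorem hasFormalDeriv_expAd (s : E →ₗ[K] C) (c : C) (x v : E) (n : ℕ) :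
    HasFormalDeriv K (fun y => expAd K (s y) c (n + 1)) x v
      (∑ p ∈ antidiagonal n, ⁅phiAd K (s x) (s v) p.1, expAd K (s x) c p.2⁆) := by
  have hs := hasFormalDeriv_linear s x v
  have hn : ∀ n, ((n + 1 : ℕ) : K) ≠ 0 := fun n => Nat.cast_ne_zero.2 n.succ_ne_zero
  have h1 : ∀ n, (fun y => expAd K (s y) c (n + 1)) =
      fun y => (((n + 1 : ℕ) : K)⁻¹ • LinearMap.id : C →ₗ[K] C) ⁅s y, expAd K (s y) c n⁆ := by
    intro n
    funext y
    rw [← expAd_succ, LinearMap.smul_apply, LinearMap.id_apply, inv_smul_smul₀ (hn n)]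
  induction n with
  | zero =>
    rw [h1]
    have := (hs.lie (hasFormalDeriv_const c x v)).map
      (((0 + 1 : ℕ) : K)⁻¹ • LinearMap.id : C →ₗ[K] C)
    simpa using this
  | succ n ih =>
    rw [h1]
    convert (hs.lie ih).map (((n + 1 + 1 : ℕ) : K)⁻¹ • LinearMap.id : C →ₗ[K] C) using 1
    rw [LinearMap.smul_apply, LinearMap.id_apply, ← smul_sum_phiAd_expAd, inv_smul_smul₀ (hn _)]

theorem hasFormalDeriv_phiAd (s : E →ₗ[K] C) {g : E → C} {x v : E} {g' : C}
    (hg : HasFormalDeriv K g x v g') (n : ℕ) :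
    HasFormalDeriv K (fun y => phiAd K (s y) (g y) n) x v
      (phiAdDeriv K (s x) (s v) (g x) n + phiAd K (s x) g' n) := by
  have hs := hasFormalDeriv_linear s x v
  induction n with
  | zero => simpa [phiAdDeriv] using hg
  | succ n ih =>
    have hn : ((n + 2 : ℕ) : K) ≠ 0 := Nat.cast_ne_zero.2 (by omega)
    have h1 : ∀ y w, phiAd K (s y) w (n + 1) =
        (((n + 2 : ℕ) : K)⁻¹ • LinearMap.id : C →ₗ[K] C) ⁅s y, phiAd K (s y) w n⁆ := by
      intro y w
      rw [← phiAd_succ, LinearMap.smul_apply, LinearMap.id_apply, inv_smul_smul₀ hn]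
    simp only [h1]
    convert (hs.lie ih).map (((n + 2 : ℕ) : K)⁻¹ • LinearMap.id : C →ₗ[K] C) using 1
    simp [phiAdDeriv, add_assoc]

end AdSeries

/-! ### The series `E_c` and `Φ`, and the Maurer-Cartan equation. -/

section AdSeriesSeries

variable {K : Type*} [Field K]
variable {E : Type*} [AddCommGroup E] [Module K E]
variable {C : Type*} [LieRing C] [LieAlgebra K C]

theorem ad_pow_apply_mem_homPoly (s : E →ₗ[K] C) {r : ℕ} (g : homPoly K E C r) {k m : ℕ}
    (h : r + k = m) : (fun y => (LieAlgebra.ad K C (s y) ^ k) (g.1 y)) ∈ homPoly K E C m := by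
  induction k generalizing m with
  | zero =>
    obtain rfl : r = m := h
    simp
  | succ k ih =>
    have h0 : (fun y => s y) ∈ homPoly K E C 1 :=
      ⟨LinearMap.compMultilinearMap s
        (MultilinearMap.ofSubsingleton K E E (0 : Fin 1) LinearMap.id), fun y => by simp⟩
    have := lie_mem_homPoly (by omega : 1 + (r + k) = m) ⟨_, h0⟩ ⟨_, ih rfl⟩
    simpa [pow_succ'] using this

/-- The series `e ^ (ad z) c`, where `z = s y`. -/
def expSeries (s : E →ₗ[K] C) (c : C) : Series K E C := fun n =>
  ⟨fun y => expAd K (s y) c n, Submodule.smul_mem _ _ (ad_pow_mem_homPoly s c n)⟩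

theorem expSeries_val (s : E →ₗ[K] C) (c : C) (n : ℕ) (y : E) :
    (expSeries s c n).1 y = expAd K (s y) c n := rfl

/-- The series `((e ^ (ad z) - 1) / ad z) h`, where `z = s y`. -/
def phiSeries (s : E →ₗ[K] C) (h : Series K E C) : Series K E C := fun n =>
  ⟨∑ p ∈ (antidiagonal n).attach, fun y => phiAd K (s y) ((h p.1.1).1 y) p.1.2,
    Submodule.sum_mem _ fun p _ => Submodule.smul_mem _ _
      (ad_pow_apply_mem_homPoly s (h p.1.1) (mem_antidiagonal.1 p.2))⟩

theorem phiSeries_val (s : E →ₗ[K] C) (h : Series K E C) (n : ℕ) (y : E) :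
    (phiSeries s h n).1 y = ∑ p ∈ antidiagonal n, phiAd K (s y) ((h p.1).1 y) p.2 := by
  rw [← Finset.sum_attach]
  simp [phiSeries]

theorem phiSeries_add (s : E →ₗ[K] C) (h h' : Series K E C) :
    phiSeries s (h + h') = phiSeries s h + phiSeries s h' :=
  Series.ext fun n y => by
    simp [phiSeries_val, phiAd_add, Finset.sum_add_distrib]

theorem phiSeries_sub (s : E →ₗ[K] C) (h h' : Series K E C) :
    phiSeries s (h - h') = phiSeries s h - phiSeries s h' := by
  rw [eq_sub_iff_add_eq, ← phiSeries_add, sub_add_cancel]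

theorem phiSeries_smul (s : E →ₗ[K] C) (a : K) (h : Series K E C) :
    phiSeries s (a • h) = a • phiSeries s h :=
  Series.ext fun n y => by
    simp [phiSeries_val, phiAd, Finset.smul_sum, smul_comm a]

/-- Since `φ(0) = 1`, the component of degree `n` is `h n` plus terms in lower components of `h`. -/
theorem phiSeries_injective (s : E →ₗ[K] C) : Function.Injective (phiSeries s) := by
  intro h h' hh
  refine Series.ext fun n => ?_
  induction n using Nat.strong_induction_on with
  | _ n ih =>
    intro y
    have key : ∀ f : Series K E C, (phiSeries s f n).1 y = (f n).1 y +
        ∑ p ∈ (antidiagonal n).erase (n, 0), phiAd K (s y) ((f p.1).1 y) p.2 := by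
      intro f
      rw [phiSeries_val, ← Finset.add_sum_erase _ _
        (mem_antidiagonal.2 (add_zero n) : (n, 0) ∈ antidiagonal n), phiAd_zero]
    have h1 := key h
    rw [hh, key h'] at h1
    have h2 : ∑ p ∈ (antidiagonal n).erase (n, 0), phiAd K (s y) ((h p.1).1 y) p.2 =
        ∑ p ∈ (antidiagonal n).erase (n, 0), phiAd K (s y) ((h' p.1).1 y) p.2 := by
      refine Finset.sum_congr rfl fun p hp => ?_
      obtain ⟨hp1, hp2⟩ := Finset.mem_erase.1 hp
      rw [mem_antidiagonal] at hp2
      rw [ih p.1 ?_ y]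
      by_contra hlt
      exact hp1 (Prod.ext (by change p.1 = n; omega) (by change p.2 = 0; omega))
    rw [h2] at h1
    exact (add_right_cancel h1).symm

theorem Series.map_id (f : Series K E C) : f.map LinearMap.id = f := rfl

theorem map_ad_pow {B : Type*} [LieRing B] [LieAlgebra K B] (p : C →ₗ⁅K⁆ B) (z c : C) (n : ℕ) :
    p ((LieAlgebra.ad K C z ^ n) c) = (LieAlgebra.ad K B (p z) ^ n) (p c) := by
  induction n with
  | zero => simp
  | succ n ih => simp [pow_succ', ih]

theorem Series.map_lie {A : Type*} [LieRing A] [LieAlgebra K A]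
    (i : A →ₗ⁅K⁆ C) (f g : Series K E A) :
    ⁅f, g⁆.map (i : A →ₗ[K] C) = ⁅f.map (i : A →ₗ[K] C), g.map (i : A →ₗ[K] C)⁆ :=
  Series.ext fun n y => by simp [Series.lie_val]

theorem Series.map_injective {F G : Type*} [AddCommGroup F] [Module K F] [AddCommGroup G]
    [Module K G] {L : F →ₗ[K] G} (hL : Function.Injective L) :
    Function.Injective (Series.map (E := E) L) := fun _ _ h =>
  Series.ext fun n y => hL (congrArg (fun f => (f n).1 y) h)

variable [CharZero K]

theorem expSeries_lie_expSeries (s : E →ₗ[K] C) (c c' : C) :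
    ⁅expSeries s c, expSeries s c'⁆ = expSeries s ⁅c, c'⁆ :=
  Series.ext fun n y => by
    simp only [Series.lie_val, expSeries_val, sum_expAd_lie_expAd]

theorem along_expSeries (s : E →ₗ[K] C) (ξ : Series K E E) (c : C) :
    ξ.along (expSeries s c) = ⁅phiSeries s (ξ.map s), expSeries s c⁆ :=
  Series.ext fun n y => by
    have h1 : ∀ m v, dirDeriv (expSeries s c (m + 1)) y v =
        ∑ p ∈ antidiagonal m, ⁅phiAd K (s y) (s v) p.1, expAd K (s y) c p.2⁆ := fun m v =>
      dirDeriv_eq (fun _ => rfl) (hasFormalDeriv_expAd s c y v m)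
    simp only [Series.along_val_dirDeriv, h1, Series.lie_val, phiSeries_val, Series.map_val,
      sum_lie, expSeries_val]
    rw [sum_antidiagonal_antidiagonal_assoc n fun a b d =>
      ⁅phiAd K (s y) (s ((ξ a).1 y)) b, expAd K (s y) c d⁆]

theorem along_phiSeries_val (s : E →ₗ[K] C) (ξ : Series K E E) (h : Series K E C) (n : ℕ) (y : E) :
    ((ξ.along (phiSeries s h)) n).1 y = ∑ p ∈ antidiagonal n, ∑ q ∈ antidiagonal p.2,
      phiAdDeriv K (s y) (s ((ξ p.1).1 y)) ((h q.1).1 y) (q.2 + 1) +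
      (phiSeries s (ξ.along h) n).1 y := by
  have h1 : ∀ m v, dirDeriv (phiSeries s h m) y v = ∑ q ∈ antidiagonal m,
      (phiAdDeriv K (s y) (s v) ((h q.1).1 y) q.2 +
        phiAd K (s y) (dirDeriv (h q.1) y v) q.2) := fun m v =>
    dirDeriv_eq (fun y => phiSeries_val s h m y) <| HasFormalDeriv.sum fun q _ =>
      hasFormalDeriv_phiAd s (hasFormalDeriv_homPoly (h q.1) y v) q.2
  have h2 : ∀ m v, dirDeriv (phiSeries s h (m + 1)) y v =
      ∑ q ∈ antidiagonal m, phiAdDeriv K (s y) (s v) ((h q.1).1 y) (q.2 + 1) +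
      ∑ q ∈ antidiagonal m, phiAd K (s y) (dirDeriv (h (q.1 + 1)) y v) q.2 := by
    intro m v
    rw [h1, Finset.sum_add_distrib, Finset.Nat.sum_antidiagonal_succ',
      Finset.Nat.sum_antidiagonal_succ]
    simp [dirDeriv_of_degree_zero, phiAdDeriv, phiAd]
  rw [Series.along_val_dirDeriv]
  simp only [h2]
  rw [Finset.sum_add_distrib, phiSeries_val]
  simp only [Series.along_val_dirDeriv, phiAd_sum]
  rw [sum_antidiagonal_antidiagonal_assoc n fun a b c =>
    phiAd K (s y) (dirDeriv (h (b + 1)) y ((ξ a).1 y)) c]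

/-- The Maurer-Cartan equation for `ξ ↦ ((e ^ (ad z) - 1) / ad z) (s ξ)`. -/
theorem along_phiSeries_sub (s : E →ₗ[K] C) (ξ η : Series K E E) :
    ξ.along (phiSeries s (η.map s)) - η.along (phiSeries s (ξ.map s)) =
      phiSeries s ((ξ.along η - η.along ξ).map s) +
        ⁅phiSeries s (ξ.map s), phiSeries s (η.map s)⁆ := by
  have h1 : (ξ.along η - η.along ξ).map s = (ξ.along η).map s - (η.along ξ).map s := by
    rw [eq_sub_iff_add_eq]
    refine Series.ext fun n y => ?_
    rw [Series.add_val, Series.map_val, Series.map_val, Series.map_val, ← map_add,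
      ← Series.add_val, sub_add_cancel]
  rw [h1, phiSeries_sub, sub_eq_iff_eq_add]
  refine Series.ext fun n y => ?_
  rw [← sub_eq_zero]
  -- Differentiating the coefficients of `φ(ad z)` and antisymmetrizing in `ξ`, `η` produces exactly
  -- the bracket term; differentiating the arguments gives the commutator term.
  have h2 : ∑ p ∈ antidiagonal n, ∑ q ∈ antidiagonal p.2,
      phiAdDeriv K (s y) (s ((ξ p.1).1 y)) (s ((η q.1).1 y)) (q.2 + 1) =
      ∑ p ∈ antidiagonal n, ∑ q ∈ antidiagonal p.2,
        phiAdDeriv K (s y) (s ((η p.1).1 y)) (s ((ξ q.1).1 y)) (q.2 + 1) +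
      (⁅phiSeries s (ξ.map s), phiSeries s (η.map s)⁆ n).1 y := by
    rw [sum_antidiagonal_antidiagonal_left_comm n fun a b c =>
      phiAdDeriv K (s y) (s ((η a).1 y)) (s ((ξ b).1 y)) (c + 1)]
    simp only [Series.lie_val, phiSeries_val, Series.map_val, sum_lie]
    rw [sum_antidiagonal_antidiagonal_assoc n fun a b c => ⁅phiAd K (s y) (s ((ξ a).1 y)) b,
        ∑ q ∈ antidiagonal c, phiAd K (s y) (s ((η q.1).1 y)) q.2⁆, ← Finset.sum_add_distrib]
    refine Finset.sum_congr rfl fun p _ => ?_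
    simp only [lie_sum]
    rw [sum_antidiagonal_antidiagonal_left_comm p.2 fun a b c =>
        ⁅phiAd K (s y) (s ((ξ p.1).1 y)) a, phiAd K (s y) (s ((η b).1 y)) c⁆,
      ← Finset.sum_add_distrib]
    refine Finset.sum_congr rfl fun q _ => ?_
    rw [← phiAdDeriv_sub_phiAdDeriv]
    abel
  rw [along_phiSeries_val, Series.along_map]
  simp only [Series.map_val]
  rw [h2, Series.add_val, along_phiSeries_val, Series.along_map, Series.add_val]
  have h3 : ∀ f g : Series K E C, ((f - g) n).1 y = (f n).1 y - (g n).1 y := fun _ _ => rfl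
  simp only [Series.map_val, h3]
  abel

end AdSeriesSeries

/-! ### The fundamental action and the series `h_c`. -/

section Wreath

variable {K : Type*} [Field K] [CharZero K]
variable {B : Type*} [LieRing B] [LieAlgebra K B]
variable {C : Type*} [LieRing C] [LieAlgebra K C]

theorem fundAction_val (b : B) (n : ℕ) (y : B) :
    (fundAction (K := K) b n).1 y = tCoeff K n • (LieAlgebra.ad K B y ^ n) b := rfl

theorem fundAction_add (b b' : B) :
    fundAction (K := K) (b + b') = fundAction b + fundAction b' :=
  Series.ext fun n y => by simp [fundAction_val]

theorem fundAction_smul (a : K) (b : B) :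
    fundAction (K := K) (a • b) = a • fundAction b :=
  Series.ext fun n y => by simp [fundAction_val, smul_comm a]

theorem sum_tCoeff_div_factorial (n : ℕ) :
    ∑ p ∈ antidiagonal n, (((p.2 + 1)! : ℕ) : K)⁻¹ * tCoeff K p.1 = ((n ! : ℕ) : K)⁻¹ := by
  have h2 : PowerSeries.constantCoeff
      (PowerSeries.mk fun n => (((n + 1)! : ℕ) : K)⁻¹) ≠ 0 := by
    simp [← PowerSeries.coeff_zero_eq_constantCoeff_apply]
  have h : genSeries K * (PowerSeries.mk fun n => (((n + 1)! : ℕ) : K)⁻¹) = PowerSeries.exp K := by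
    rw [genSeries, mul_assoc, PowerSeries.inv_mul_cancel _ h2, mul_one]
  have h3 := congrArg (PowerSeries.coeff n) h
  rw [PowerSeries.coeff_mul] at h3
  simpa [PowerSeries.coeff_exp, tCoeff, mul_comm] using h3

/-- This is `(T e^T / (e^T - 1)) φ(T) = e^T` at `T = ad y`. With injectivity of `phiSeries`, it
characterizes `d_b`. -/
theorem phiSeries_fundAction (b : B) :
    phiSeries LinearMap.id (fundAction (K := K) b) = expSeries LinearMap.id b :=
  Series.ext fun n y => by
    rw [phiSeries_val, expSeries_val, expAd, ← sum_tCoeff_div_factorial, Finset.sum_smul]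
    refine Finset.sum_congr rfl fun p hp => ?_
    rw [phiAd, fundAction_val, map_smul, smul_smul, ← mem_antidiagonal.1 hp, add_comm p.1, pow_add]
    rfl

/-- The fundamental action is a homomorphism to vector fields. -/
theorem fundAction_lie (b b' : B) : fundAction (K := K) ⁅b, b'⁆ =
    (fundAction b).along (fundAction b') - (fundAction b').along (fundAction b) := by
  refine phiSeries_injective LinearMap.id ?_
  have h := along_phiSeries_sub LinearMap.id (fundAction (K := K) b) (fundAction b')
  simp only [Series.map_id, phiSeries_fundAction, along_expSeries] at h
  rw [phiSeries_fundAction, ← expSeries_lie_expSeries]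
  -- Here `h` reads `[E_b, E_b'] - [E_b', E_b] = Φ(d_b d_b' - d_b' d_b) + [E_b, E_b']`; one copy of
  -- `[E_b, E_b']` cancels.
  rw [add_comm, sub_eq_add_neg, lie_skew] at h
  exact add_left_cancel h

/-- The derivative along a series as a linear map. -/
def alongLinearMap (K A B : Type*) [Field K] [CharZero K] [AddCommGroup A] [Module K A]
    [AddCommGroup B] [Module K B] (ξ : Series K B B) : Series K B A →ₗ[K] Series K B A where
  toFun f := ξ.along f
  map_add' := Series.along_add _
  map_smul' := Series.along_smul _

/-- The derivative along a series as a derivation of the Lie algebra `A[[B]]`. -/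
def alongDerivation (K A B : Type*) [Field K] [CharZero K] [LieRing A] [LieAlgebra K A]
    [AddCommGroup B] [Module K B] (ξ : Series K B B) :
    LieDerivation K (Series K B A) (Series K B A) where
  toLinearMap := alongLinearMap K A B ξ
  leibniz' f g := by
    have h : ξ.along ⁅f, g⁆ = ⁅f, ξ.along g⁆ - ⁅g, ξ.along f⁆ := by
      rw [Series.along_lie, ← lie_skew _ g]
      abel
    exact h

/-- The action of `B` on `A[[B]]` by derivations. -/
def fundActionHom (K A B : Type*) [Field K] [CharZero K] [LieRing A] [LieAlgebra K A] [LieRing B]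
    [LieAlgebra K B] : B →ₗ⁅K⁆ LieDerivation K (Series K B A) (Series K B A) where
  toFun b := alongDerivation K A B (fundAction b)
  map_add' b b' := LieDerivation.ext fun f => by
    change (fundAction (b + b')).along f = (fundAction b).along f + (fundAction b').along f
    rw [fundAction_add, Series.add_along]
  map_smul' a b := LieDerivation.ext fun f => by
    change (fundAction (a • b)).along f = a • (fundAction b).along f
    rw [fundAction_smul, Series.smul_along]
  map_lie' {b b'} := LieDerivation.ext fun f => by
    rw [LieDerivation.lie_apply]
    change (fundAction ⁅b, b'⁆).along f = (fundAction b).along ((fundAction b').along f) -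
      (fundAction b').along ((fundAction b).along f)
    rw [fundAction_lie, Series.along_commutator]

theorem fundActionHom_apply {A : Type*} [LieRing A] [LieAlgebra K A] (b : B) (f : Series K B A) :
    fundActionHom K A B b f = (fundAction b).along f := rfl

/-- The series with components `repFormula p s c`. -/
def repSeries (p : C →ₗ⁅K⁆ B) (s : B →ₗ[K] C) (c : C) : Series K B C :=
  expSeries s c - phiSeries s ((fundAction (p c)).map s)

theorem repSeries_val (p : C →ₗ⁅K⁆ B) (s : B →ₗ[K] C) (hs : ∀ y, p (s y) = y) (c : C) (m : ℕ)
    (y : B) : (repSeries p s c m).1 y = repFormula p s c m y := by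
  change expAd K (s y) c m - (phiSeries s ((fundAction (p c)).map s) m).1 y = _
  rw [phiSeries_val, expAd, repFormula, ← Finset.Nat.sum_antidiagonal_swap]
  congr 1
  refine Finset.sum_congr rfl fun q _ => ?_
  rw [map_ad_pow, hs, phiAd, Series.map_val, fundAction_val, map_smul, map_smul, smul_smul,
    div_eq_inv_mul]
  rfl

theorem map_repSeries (p : C →ₗ⁅K⁆ B) (s : B →ₗ[K] C) (hs : ∀ y, p (s y) = y) (c : C) :
    (repSeries p s c).map (p : C →ₗ[K] B) = 0 :=
  Series.ext fun m y => by
    change p (expAd K (s y) c m - (phiSeries s ((fundAction (p c)).map s) m).1 y) = 0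
    have h := congrArg (fun f => (f m).1 y) (phiSeries_fundAction (K := K) (p c))
    simp only [phiSeries_val, expSeries_val, phiAd, expAd, LinearMap.id_apply] at h
    rw [map_sub, sub_eq_zero, phiSeries_val, expAd, map_smul, map_ad_pow, hs, ← h, map_sum]
    refine Finset.sum_congr rfl fun q _ => ?_
    rw [phiAd, map_smul, map_ad_pow, hs, Series.map_val, hs]

/-- Maurer-Cartan supplies `Φ(d_{p⁅c,c'⁆})`, and its term `[Φ, Φ']` and the mixed brackets of `E`
and `Φ` all cancel. -/
theorem repSeries_lie (p : C →ₗ⁅K⁆ B) (s : B →ₗ[K] C) (c c' : C) :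
    repSeries p s ⁅c, c'⁆ = ⁅repSeries p s c, repSeries p s c'⁆ +
      (fundAction (p c)).along (repSeries p s c') -
      (fundAction (p c')).along (repSeries p s c) := by
  have h := along_phiSeries_sub s (fundAction (K := K) (p c)) (fundAction (p c'))
  rw [← fundAction_lie, ← LieHom.map_lie] at h
  simp only [repSeries, Series.along_sub, along_expSeries, lie_sub, sub_lie]
  rw [eq_sub_of_add_eq h.symm, expSeries_lie_expSeries,
    ← lie_skew (expSeries s c) (phiSeries s ((fundAction (p c')).map s))]
  abel

theorem repSeries_add (p : C →ₗ⁅K⁆ B) (s : B →ₗ[K] C) (c c' : C) :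
    repSeries p s (c + c') = repSeries p s c + repSeries p s c' := by
  have h1 : expSeries s (c + c') = expSeries s c + expSeries s c' :=
    Series.ext fun m y => by simp [expSeries_val, expAd]
  have h2 : (fundAction (K := K) (p (c + c'))).map s =
      (fundAction (p c)).map s + (fundAction (p c')).map s :=
    Series.ext fun m y => by simp [fundAction_val]
  rw [repSeries, h1, h2, phiSeries_add, repSeries, repSeries]
  abel

theorem repSeries_smul (p : C →ₗ⁅K⁆ B) (s : B →ₗ[K] C) (a : K) (c : C) :
    repSeries p s (a • c) = a • repSeries p s c := by
  have h1 : expSeries s (a • c) = a • expSeries s c :=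
    Series.ext fun m y => by simp [expSeries_val, expAd, smul_comm a]
  have h2 : (fundAction (K := K) (p (a • c))).map s = a • (fundAction (p c)).map s :=
    Series.ext fun m y => by simp [fundAction_val, smul_comm a]
  rw [repSeries, h1, h2, phiSeries_smul, repSeries, smul_sub]

theorem repSeries_zero_val (p : C →ₗ⁅K⁆ B) (s : B →ₗ[K] C) {c : C} (hc : p c = 0) (y : B) :
    (repSeries p s c 0).1 y = c := by
  change expAd K (s y) c 0 - (phiSeries s ((fundAction (p c)).map s) 0).1 y = c
  simp [phiSeries_val, fundAction_val, hc]

end Wreath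

end LieWreath

end

/-! ### The embedding of `C` into the wreath product. -/

theorem mainTheorem1 {K : Type*} [Field K] [CharZero K]
    {A : Type*} [LieRing A] [LieAlgebra K A]
    {B : Type*} [LieRing B] [LieAlgebra K B]
    {C : Type*} [LieRing C] [LieAlgebra K C]
    (i : A →ₗ⁅K⁆ C) (p : C →ₗ⁅K⁆ B) (hext : LieAlgebra.IsExtension i p)
    (s : B →ₗ[K] C) (hs : ∀ y : B, p (s y) = y) :
    ∃ σ : B →ₗ⁅K⁆ LieDerivation K (LieWreath.Series K B A) (LieWreath.Series K B A),
      (∀ (b : B) (a : LieWreath.Series K B A), σ b a = (LieWreath.fundAction b).along a) ∧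
      ∃ f : C →ₗ⁅K⁆ LieAlgebra.SemiDirectSum (LieWreath.Series K B A) B σ,
        Function.Injective f ∧
        ∀ c : C, (f c).right = p c ∧
          ∀ (m : ℕ) (y : B), i (((f c).left m).1 y) = LieWreath.repFormula p s c m y := by
  open LieWreath in
  have hi : Function.Injective i := (LieHom.ker_eq_bot i).1 hext.ker_eq_bot
  -- A linear retraction `g` of `C` onto `A` pulls `h_c` back to `A[[B]]`: composing with `g` keeps
  -- components homogeneous polynomials, and `i ∘ g` fixes the kernel of `p`.
  obtain ⟨g, hg⟩ := LinearMap.exists_leftInverse_of_injective (i : A →ₗ[K] C)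
    (LinearMap.ker_eq_bot.2 hi)
  have hgi : ∀ x, p x = 0 → i (g x) = x := by
    intro x hx
    have : Function.Exact i p := (LieHom.range_eq_ker_iff i p).1 hext.exact
    obtain ⟨a, rfl⟩ := (this x).1 hx
    exact congrArg i (LinearMap.congr_fun hg a)
  have hval : ∀ c m y, i (g ((repSeries p s c m).1 y)) = (repSeries p s c m).1 y := fun c m y =>
    hgi _ (congrArg (fun f => (f m).1 y) (map_repSeries p s hs c))
  have hmap : ∀ c, ((repSeries p s c).map g).map (i : A →ₗ[K] C) = repSeries p s c := fun c =>
    Series.ext fun m y => hval c m y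
  refine ⟨fundActionHom K A B, fundActionHom_apply, ?_⟩
  refine ⟨
    { toFun := fun c => ⟨(repSeries p s c).map g, p c⟩
      map_add' := fun c c' => ?_
      map_smul' := fun a c => ?_
      map_lie' := fun {c c'} => ?_ }, ?_, fun c => ⟨rfl, fun m y => ?_⟩⟩
  · rw [LieAlgebra.SemiDirectSum.add_eq_mk]
    refine LieAlgebra.SemiDirectSum.ext ?_ (map_add p c c')
    exact Series.ext fun m y => by simp [repSeries_add]
  · rw [LieAlgebra.SemiDirectSum.smul_eq_mk]
    refine LieAlgebra.SemiDirectSum.ext ?_ (map_smul p a c)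
    exact Series.ext fun m y => by simp [repSeries_smul]
  · rw [LieAlgebra.SemiDirectSum.lie_eq_mk]
    refine LieAlgebra.SemiDirectSum.ext ?_ (LieHom.map_lie p c c')
    -- The map `g` need not respect brackets, so the identity is checked in `C[[B]]` after applying
    -- `i`.
    refine Series.map_injective (L := (i : A →ₗ[K] C)) hi ?_
    have hadd : ∀ u v w : Series K B A, (u + v - w).map (i : A →ₗ[K] C) =
        u.map (i : A →ₗ[K] C) + v.map (i : A →ₗ[K] C) - w.map (i : A →ₗ[K] C) := by
      intro u v w
      refine Series.ext fun m y => ?_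
      change i ((u m).1 y + (v m).1 y - (w m).1 y) = i ((u m).1 y) + i ((v m).1 y) - i ((w m).1 y)
      simp
    simp only [fundActionHom_apply, hadd, Series.map_lie, ← Series.along_map, hmap]
    exact repSeries_lie p s c c'
  · rw [injective_iff_map_eq_zero]
    intro c hc
    have hp : p c = 0 := congrArg LieAlgebra.SemiDirectSum.right hc
    have h0 : (repSeries p s c).map g = 0 := congrArg LieAlgebra.SemiDirectSum.left hc
    rw [← repSeries_zero_val p s hp 0, ← hmap c, h0]
    simp
  · exact (hval c m y).trans (repSeries_val p s hs c m y)
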